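/- Let $\mathcal S^n$ be the space of real symmetric $n\times n$ matrices with the Frobenius inner product $\langle\cdot,\cdot\rangle$ and norm $\|\cdot\|$, let $\mathcal S^n_+$ and $\mathcal S^n_-$ be the cones of positive and of negative semidefinite matrices, $\Pi_{\mathcal S^n_-}$ the metric projection onto $\mathcal S^n_-$, $N_{\mathcal S^n_+}$ the normal cone mapping of $\mathcal S^n_+$, and $\delta=\delta_{\mathcal S^n_+}$ the indicator function of $\mathcal S^n_+$ ($0$ on $\mathcal S^n_+$ and $+\infty$ elsewhere). For $f:\mathcal S^n\to[-\infty,+\infty]$ and $\rho>0$ let $e_\rho f(Y)=\inf_{Z\in\mathcal S^n}\{f(Z)+\frac1{2\rho}\|Z-Y\|^2\}$ be the Moreau envelope, $e\delta:=e_1\delta$, and for $f(X)$ finite let $$\mathrm d^2f(X,\Gamma)(W)=\liminf_{t\downarrow0,\;W'\to W}\frac{f(X+tW')-f(X)-t\langle\Gamma,W'\rangle}{\frac12t^2}$$ be the second subderivative. Let $\lambda_1(A)\ge\dots\ge\lambda_n(A)$ denote the ordered eigenvalues of $A\in\mathcal S^n$. Write $\pi(A)=\pi(\bar A)$ if $A$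 and $\bar A$ have the same index sets of distinct eigenvalues, that is, $\lambda_i(A)=\lambda_j(A)\iff\lambda_i(\bar A)=\lambda_j(\bar A)$ for all $i,j$, and the same index sets $\alpha=\{i:\lambda_i>0\}$, $\beta=\{i:\lambda_i=0\}$, $\gamma=\{i:\lambda_i<0\}$. Let $G$ be a mapping with values in $\mathcal S^n$, let $\bar x$ be a point of its domain, let $\bar\Gamma\in N_{\mathcal S^n_+}(G(\bar x))$ (in particular $G(\bar x)\in\mathcal S^n_+$), and put $\bar A=G(\bar x)+\bar\Gamma$. Let $r>0$ satisfy $r<\frac13(v-v')$ for any two eigenvalues $v>v'$ of $\bar A$, and $r<|v|$ for every negative eigenvalue $v$ of $\bar A$. Then there are constants $l>0$ and $\delta_0>0$ such that for every $A=G(\bar x)+\Gamma$ with $\Gamma\in N_{\mathcal S^n_+}(G(\bar x))$, $\|A-\bar A\|\le r$ and $\pi(A)=\pi(\bar A)$, and for every $H\in\mathcal S^n$ with $\|H\|\le\delta_0$, the values $e\delta(A+H)$, $e\delta(A)$ and $e_{1/2}\big(\mathrm d^2\delta(G(\bar x),\Gamma)\big)(H)$ are finite and $$\Big|\,e\delta(A+H)-e\delta(A)-\langle\Pi_{\mathcal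 S^n_-}(A),H\rangle-\tfrac12\,e_{1/2}\big(\mathrm d^2\delta(G(\bar x),\Gamma)\big)(H)\Big|\le l\,\|H\|^3 .$$ That is, the expansion $e\delta(A+H)-e\delta(A)=\langle\Pi_{\mathcal S^n_-}(A),H\rangle+\frac12e_{1/2}(\mathrm d^2\delta(G(\bar x),\Gamma))(H)+O(\|H\|^3)$ holds with $O(\|H\|^3)$ uniform over all such $A$. -/

import Mathlib

open Filter Topology

/-! ### The space of symmetric matrices with the Frobenius inner product -/

/-- The subspace of symmetric matrices. -/
def symSubmodule (n : ℕ) : Submodule ℝ (Matrix (Fin n) (Fin n) ℝ) where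
  carrier := {A | A.IsSymm}
  add_mem' hA hB := hA.add hB
  zero_mem' := Matrix.isSymm_zero
  smul_mem' c _ hA := hA.smul c

/-- The space `𝒮ⁿ` of real symmetric `n × n` matrices. It is made a Euclidean space below, with
the Frobenius inner product. -/
def SymMat (n : ℕ) : Type := symSubmodule n

noncomputable instance SymMat.instAddCommGroup (n : ℕ) : AddCommGroup (SymMat n) :=
  inferInstanceAs (AddCommGroup (symSubmodule n))

noncomputable instance SymMat.instModule (n : ℕ) : Module ℝ (SymMat n) :=
  inferInstanceAs (Module ℝ (symSubmodule n))

/-- The underlying matrix. -/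
def SymMat.mat {n : ℕ} (A : SymMat n) : Matrix (Fin n) (Fin n) ℝ := A.1

theorem SymMat.mat_isSymm {n : ℕ} (A : SymMat n) : A.mat.IsSymm := A.2

/-- The Frobenius inner product `⟨A, B⟩ = ∑ i j, A i j * B i j = tr (Aᵀ B)`. -/
@[reducible] noncomputable def SymMat.frobeniusCore (n : ℕ) :
    InnerProductSpace.Core ℝ (SymMat n) where
  inner A B := ∑ i, ∑ j, A.mat i j * B.mat i j
  conj_inner_symm A B := by simp [mul_comm]
  re_inner_nonneg A := by
    have h : 0 ≤ ∑ i, ∑ j, A.mat i j * A.mat i j :=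
      Finset.sum_nonneg fun i _ => Finset.sum_nonneg fun j _ => mul_self_nonneg _
    simpa using h
  add_left A B C := by
    have h : (A + B).mat = A.mat + B.mat := rfl
    simp [h, add_mul, Finset.sum_add_distrib]
  smul_left A B c := by
    have h : (c • A).mat = c • A.mat := rfl
    simp [h, Finset.mul_sum, mul_assoc]
  definite A h := by
    have h0 : ∀ i, ∀ j, A.mat i j = 0 := by
      intro i j
      have h1 := (Finset.sum_eq_zero_iff_of_nonneg fun i _ =>
        Finset.sum_nonneg fun j _ => mul_self_nonneg (A.mat i j)).1 h i (Finset.mem_univ i)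
      have h2 := (Finset.sum_eq_zero_iff_of_nonneg fun j _ =>
        mul_self_nonneg (A.mat i j)).1 h1 j (Finset.mem_univ j)
      exact mul_self_eq_zero.1 h2
    exact Subtype.ext (Matrix.ext h0)

/-- The Frobenius norm, induced by the Frobenius inner product. -/
noncomputable instance SymMat.instNormedAddCommGroup (n : ℕ) : NormedAddCommGroup (SymMat n) :=
  (SymMat.frobeniusCore n).toNormedAddCommGroup

noncomputable instance SymMat.instInnerProductSpace (n : ℕ) : InnerProductSpace ℝ (SymMat n) :=
  InnerProductSpace.ofCore (SymMat.frobeniusCore n).toCore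

instance SymMat.instFiniteDimensional (n : ℕ) : FiniteDimensional ℝ (SymMat n) :=
  inferInstanceAs (FiniteDimensional ℝ (symSubmodule n))

theorem SymMat.inner_def {n : ℕ} (A B : SymMat n) :
    inner ℝ A B = ∑ i, ∑ j, A.mat i j * B.mat i j := rfl

theorem SymMat.isHermitian {n : ℕ} (A : SymMat n) :
    A.mat.IsHermitian := by
  have h : A.mat.IsSymm := A.2
  rwa [Matrix.IsHermitian, Matrix.conjTranspose_eq_transpose_of_trivial]

/-- The eigenvalues `λ₁(A) ≥ λ₂(A) ≥ … ≥ λₙ(A)` in nonincreasing order, counting multiplicity. -/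
noncomputable def SymMat.eig {n : ℕ} (A : SymMat n) : Fin (Fintype.card (Fin n)) → ℝ :=
  A.isHermitian.eigenvalues₀

/-- `𝒮ⁿ₊`. -/
noncomputable def psdCone (n : ℕ) : Set (SymMat n) :=
  {A | A.mat.PosSemidef}

/-- `𝒮ⁿ₋`. -/
noncomputable def nsdCone (n : ℕ) : Set (SymMat n) :=
  {A | (-A.mat).PosSemidef}

/-- `π(A) = π(B)`: the ordered eigenvalues of `A` and `B` have the same index sets of distinct
eigenvalues, and the same index sets of positive, of zero and of negative eigenvalues. Since the
eigenvalues are sorted, the first condition says that the blocks of equal eigenvalues agree, in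
the same order. -/
def SamePartition {n : ℕ} (A B : SymMat n) : Prop :=
  (∀ i j, A.eig i = A.eig j ↔ B.eig i = B.eig j) ∧
  {i | 0 < A.eig i} = {i | 0 < B.eig i} ∧
  {i | A.eig i = 0} = {i | B.eig i = 0} ∧
  {i | A.eig i < 0} = {i | B.eig i < 0}

/-! ### Variational analysis on a Euclidean space -/

section Variational

variable {E : Type*} [NormedAddCommGroup E] [InnerProductSpace ℝ E]

/-- The normal cone of a convex set `C` at `x` (empty when `x ∉ C`). -/
noncomputable def normalCone (C : Set E) (x : E) : Set E :=
  {v | x ∈ C ∧ ∀ x' ∈ C, inner ℝ v (x' - x) ≤ 0}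

open Classical in
/-- The indicator function `δ_C`: `0` on `C` and `+∞` outside. -/
noncomputable def convIndicator (C : Set E) (x : E) : EReal :=
  if x ∈ C then 0 else ⊤

/-- The metric projection onto `C`: a point of `C` nearest to `y`. It exists and is unique when
`C` is nonempty, closed and convex and `E` is finite-dimensional. -/
noncomputable def metricProj (C : Set E) (y : E) : E :=
  Classical.epsilon fun x => x ∈ C ∧ ∀ z ∈ C, ‖y - x‖ ≤ ‖y - z‖

/-- The Moreau envelope `e_ρ f (y) = inf_x { f x + ‖x - y‖² / (2ρ) }`. -/
noncomputable def moreauEnv (ρ : ℝ) (f : E → EReal) (y : E) : EReal :=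
  ⨅ x : E, f x + ((1 / (2 * ρ) * ‖x - y‖ ^ 2 : ℝ) : EReal)

/-- The second subderivative of `f` at `x` for `v`: the lower limit, as `t ↓ 0` and `w' → w`, of
`(f (x + t w') - f x - t ⟨v, w'⟩) / (t² / 2)`. -/
noncomputable def secondSubderiv (f : E → EReal) (x v w : E) : EReal :=
  liminf (fun p : ℝ × E =>
      (f (x + p.1 • p.2) - f x - ((p.1 * inner ℝ v p.2 : ℝ) : EReal)) /
        ((p.1 ^ 2 / 2 : ℝ) : EReal))
    (𝓝[>] (0 : ℝ) ×ˢ 𝓝 w)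

end Variational

/-! Write X for `G xbar` and J for its Moore–Penrose inverse, and split A + H = Z + N with Z ⪰ 0 ⪰ N
and ZN = 0. The envelopes at A + H and A are ½‖N‖² and ½‖Γ‖², and Γ is the projection of A. So it
suffices that m = ‖N‖² − ‖Γ‖² − 2⟨Γ,H⟩ and the envelope q of the second subderivative differ by
O(‖H‖³).

Both are optimal values. The number m minimises ‖V − H‖² − 2⟨Γ,V⟩ over X + V ⪰ 0. The number q is
the infimum of ‖W − H‖² − 2⟨Γ,WJW⟩ over critical W (tangent to the cone at X, with ⟨Γ,W⟩ = 0),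
because the second subderivative is −2⟨Γ,WJW⟩ there and +∞ elsewhere (`secondSubderiv_le`,
`of_secondSubderiv_lt`).

Near-optimal points of one problem are moved to the other by changes of order ‖H‖². A critical W
becomes feasible after adding `correction X J W`, whose pairing with Γ is exactly ⟨Γ,WJW⟩
(`le_moreauEnv_secondSubderiv`). Conversely, the minimiser W = Z − X becomes critical after removing
a part R that leaves the curvature unchanged (`exists_critical_near`,
`moreauEnv_secondSubderiv_le`).

The constants involve only J, ‖Γ‖ and the norm of the pseudoinverse of Γ. The last is uniformly
bounded: nonzero eigenvalues of Γ are negative eigenvalues of A, which by Weyl's inequality and the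
common index set stay away from 0. -/

open Matrix

attribute [local instance] Matrix.frobeniusNormedRing Matrix.frobeniusNormedAlgebra

/-! ### Symmetric matrices as matrices -/

namespace SymMat

variable {n : ℕ}

@[simp] theorem mat_add (A B : SymMat n) : (A + B).mat = A.mat + B.mat := rfl
@[simp] theorem mat_sub (A B : SymMat n) : (A - B).mat = A.mat - B.mat := rfl
@[simp] theorem mat_zero : (0 : SymMat n).mat = 0 := rfl
@[simp] theorem mat_smul (c : ℝ) (A : SymMat n) : (c • A).mat = c • A.mat := rfl
@[simp] theorem mat_transpose (A : SymMat n) : A.matᵀ = A.mat := A.mat_isSymm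

theorem mat_injective : Function.Injective (SymMat.mat (n := n)) := fun _ _ h => Subtype.ext h

/-- A symmetric matrix as an element of `SymMat n`. -/
def ofMat (M : Matrix (Fin n) (Fin n) ℝ) (h : Mᵀ = M) : SymMat n := ⟨M, h⟩

@[simp] theorem mat_ofMat (M : Matrix (Fin n) (Fin n) ℝ) (h : Mᵀ = M) : (ofMat M h).mat = M := rfl

theorem inner_eq_trace (A B : SymMat n) : inner ℝ A B = (A.mat * B.mat).trace := by
  rw [inner_def]
  simp only [trace, diag, Matrix.mul_apply]
  refine Finset.sum_congr rfl fun i _ => Finset.sum_congr rfl fun j _ => ?_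
  rw [← B.mat_isSymm.apply i j]

theorem norm_mat (A : SymMat n) : ‖A.mat‖ = ‖A‖ := by
  rw [frobenius_norm_def, norm_eq_sqrt_real_inner, inner_def, Real.sqrt_eq_rpow]
  simp [sq]

theorem continuous_mat : Continuous (SymMat.mat (n := n)) := by
  have h : LipschitzWith 1 (SymMat.mat (n := n)) := LipschitzWith.of_dist_le_mul fun A B => by
    rw [dist_eq_norm, dist_eq_norm, ← mat_sub, norm_mat]; simp
  exact h.continuous

end SymMat

/-! ### Traces of products of positive semidefinite matrices -/

section

variable {n : ℕ} {M N : Matrix (Fin n) (Fin n) ℝ}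

theorem Matrix.PosSemidef.mul_mul_transpose (hM : M.PosSemidef) (B : Matrix (Fin n) (Fin n) ℝ) :
    (B * M * Bᵀ).PosSemidef := by
  simpa [conjTranspose_eq_transpose_of_trivial] using hM.mul_mul_conjTranspose_same B

theorem Matrix.PosSemidef.exists_eq_transpose_mul (hM : M.PosSemidef) :
    ∃ B : Matrix (Fin n) (Fin n) ℝ, M = Bᵀ * B := by
  open scoped MatrixOrder in
  obtain ⟨B, hB⟩ := CStarAlgebra.nonneg_iff_eq_star_mul_self.mp hM.nonneg
  exact ⟨B, by rw [hB, star_eq_conjTranspose, conjTranspose_eq_transpose_of_trivial]⟩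

theorem trace_mul_transpose_self_eq_norm_sq : (M * Mᵀ).trace = ‖M‖ ^ 2 := by
  rw [frobenius_norm_def, ← Real.sqrt_eq_rpow, Real.sq_sqrt (by positivity)]
  simp [trace, Matrix.mul_apply, sq]

theorem Matrix.PosSemidef.trace_mul_nonneg (hM : M.PosSemidef) (hN : N.PosSemidef) :
    0 ≤ (M * N).trace := by
  obtain ⟨B, rfl⟩ := hM.exists_eq_transpose_mul
  rw [Matrix.mul_assoc, trace_mul_comm]
  exact (hN.mul_mul_transpose B).trace_nonneg

/-- With M = BᵀB and N = CᵀC, the trace is ‖BCᵀ‖². -/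
theorem Matrix.PosSemidef.mul_eq_zero_of_trace_mul_eq_zero (hM : M.PosSemidef)
    (hN : N.PosSemidef) (h : (M * N).trace = 0) : M * N = 0 := by
  obtain ⟨B, rfl⟩ := hM.exists_eq_transpose_mul
  obtain ⟨C, rfl⟩ := hN.exists_eq_transpose_mul
  have h1 : ((B * Cᵀ) * (B * Cᵀ)ᵀ).trace = 0 := by
    rw [← h, transpose_mul, transpose_transpose, Matrix.mul_assoc Bᵀ, trace_mul_comm Bᵀ]
    simp only [Matrix.mul_assoc]
  rw [trace_mul_transpose_self_eq_norm_sq] at h1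
  have h2 : B * Cᵀ = 0 := by simpa using h1
  calc Bᵀ * B * (Cᵀ * C) = Bᵀ * (B * Cᵀ) * C := by simp only [Matrix.mul_assoc]
    _ = 0 := by rw [h2]; simp

theorem isClosed_posSemidef : IsClosed {M : Matrix (Fin n) (Fin n) ℝ | M.PosSemidef} := by
  have : {M : Matrix (Fin n) (Fin n) ℝ | M.PosSemidef}
      = {M | Mᵀ = M} ∩ ⋂ x : Fin n → ℝ, {M | 0 ≤ x ⬝ᵥ (M *ᵥ x)} := by
    ext M
    simp [posSemidef_iff_dotProduct_mulVec, IsHermitian, conjTranspose_eq_transpose_of_trivial]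
  rw [this]
  refine (isClosed_eq (by fun_prop) continuous_id).inter (isClosed_iInter fun x => ?_)
  exact isClosed_le continuous_const (by fun_prop)

end

namespace SymMat

variable {n : ℕ}

/-! ### Spectral decomposition -/

theorem exists_diagonalization (A : SymMat n) :
    ∃ U : Matrix (Fin n) (Fin n) ℝ, Uᵀ * U = 1 ∧ U * Uᵀ = 1 ∧
      A.mat = U * diagonal A.isHermitian.eigenvalues * Uᵀ := by
  have h := A.isHermitian.eigenvectorUnitary.2
  rw [mem_unitaryGroup_iff, star_eq_conjTranspose, conjTranspose_eq_transpose_of_trivial] at h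
  refine ⟨A.isHermitian.eigenvectorUnitary, mul_eq_one_comm.mp h, h, ?_⟩
  have h2 := A.isHermitian.spectral_theorem
  rw [Unitary.conjStarAlgAut_apply] at h2
  simpa [star_eq_conjTranspose, conjTranspose_eq_transpose_of_trivial, Function.comp_def] using h2

theorem eigenvalues_eq_eig (A : SymMat n) (k : Fin n) :
    A.isHermitian.eigenvalues k
      = A.eig ((Fintype.equivOfCardEq (Fintype.card_fin _)).symm k) := rfl

theorem dotProduct_mulVec_le (A : SymMat n) (x : Fin n → ℝ) :
    x ⬝ᵥ (A.mat *ᵥ x) ≤ ‖A‖ * (x ⬝ᵥ x) := by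
  let B : SymMat n := ofMat (vecMulVec x x) (transpose_vecMulVec x x)
  have h1 : inner ℝ A B = x ⬝ᵥ (A.mat *ᵥ x) := by
    rw [inner_def]
    simp only [B, mat_ofMat, vecMulVec_apply, dotProduct, mulVec, Finset.mul_sum]
    exact Finset.sum_congr rfl fun i _ => Finset.sum_congr rfl fun j _ => by ring
  have h2 : ‖B‖ = x ⬝ᵥ x := by
    have h0 : 0 ≤ x ⬝ᵥ x := Finset.sum_nonneg fun i _ => mul_self_nonneg (x i)
    rw [norm_eq_sqrt_real_inner, ← Real.sqrt_sq h0, inner_def]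
    congr 1
    simp only [B, mat_ofMat, vecMulVec_apply, dotProduct, sq, Finset.sum_mul_sum]
    exact Finset.sum_congr rfl fun i _ => Finset.sum_congr rfl fun j _ => by ring
  rw [← h1, ← h2]
  exact real_inner_le_norm A B

/-- Weyl's inequality. -/
theorem eig_le_eig_add_norm_sub (A B : SymMat n) (i : Fin (Fintype.card (Fin n))) :
    A.eig i ≤ B.eig i + ‖A - B‖ := by
  obtain ⟨U, hU, hU', hA⟩ := A.exists_diagonalization
  obtain ⟨V, hV, hV', hB⟩ := B.exists_diagonalization
  set e : Fin (Fintype.card (Fin n)) ≃ Fin n := Fintype.equivOfCardEq (Fintype.card_fin _)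
  have key : ∀ {C : SymMat n} {U : Matrix (Fin n) (Fin n) ℝ},
      C.mat = U * diagonal C.isHermitian.eigenvalues * Uᵀ → ∀ x,
      x ⬝ᵥ (C.mat *ᵥ x) = ∑ k, C.eig (e.symm k) * (Uᵀ *ᵥ x) k ^ 2 := by
    intro C U hC x
    rw [hC, ← mulVec_mulVec, ← mulVec_mulVec, dotProduct_mulVec, ← mulVec_transpose]
    simp only [dotProduct, mulVec_diagonal, eigenvalues_eq_eig]
    exact Finset.sum_congr rfl fun k _ => by ring
  have key2 : ∀ {U : Matrix (Fin n) (Fin n) ℝ}, U * Uᵀ = 1 → ∀ x : Fin n → ℝ,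
      x ⬝ᵥ x = ∑ k, (Uᵀ *ᵥ x) k ^ 2 := by
    intro U h x
    have h1 : x ⬝ᵥ x = x ⬝ᵥ ((U * Uᵀ) *ᵥ x) := by rw [h, one_mulVec]
    rw [h1, ← mulVec_mulVec, dotProduct_mulVec, ← mulVec_transpose]
    simp only [dotProduct, sq]
  -- Dimension count: one linear condition for each index other than `i` leaves some x ≠ 0
  -- orthogonal to the eigenvectors of A after `i` and to those of B before `i`.
  let L : (Fin n → ℝ) →ₗ[ℝ] ({k : Fin n // e.symm k ≠ i} → ℝ) :=
    LinearMap.pi fun k => if i < e.symm k.1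
      then LinearMap.proj k.1 ∘ₗ Uᵀ.mulVecLin else LinearMap.proj k.1 ∘ₗ Vᵀ.mulVecLin
  have hrank : Module.finrank ℝ ({k : Fin n // e.symm k ≠ i} → ℝ)
      < Module.finrank ℝ (Fin n → ℝ) := by
    rw [Module.finrank_fintype_fun_eq_card, Module.finrank_fintype_fun_eq_card]
    exact Fintype.card_subtype_lt (x := e i) (by simp)
  obtain ⟨x, hx, hx0⟩ := (Submodule.ne_bot_iff _).mp (L.ker_ne_bot_of_finrank_lt hrank)
  have hLx : ∀ k, e.symm k ≠ i → if i < e.symm k then (Uᵀ *ᵥ x) k = 0 else (Vᵀ *ᵥ x) k = 0 := by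
    intro k hk
    have := congrFun (LinearMap.mem_ker.mp hx) ⟨k, hk⟩
    by_cases h : i < e.symm k
    · simpa [L, h, mulVec_transpose] using this
    · simpa [L, h, mulVec_transpose] using this
  have hpos : 0 < x ⬝ᵥ x := by
    refine lt_of_le_of_ne (Finset.sum_nonneg fun k _ => mul_self_nonneg (x k)) fun h => ?_
    exact hx0 (dotProduct_self_eq_zero.mp h.symm)
  have h1 : A.eig i * (x ⬝ᵥ x) ≤ x ⬝ᵥ (A.mat *ᵥ x) := by
    rw [key hA, key2 hU', Finset.mul_sum]
    refine Finset.sum_le_sum fun k _ => ?_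
    by_cases h : i < e.symm k
    · have := hLx k h.ne'
      simp only [h, if_true] at this
      simp [this]
    · exact mul_le_mul_of_nonneg_right (A.isHermitian.eigenvalues₀_antitone (not_lt.mp h))
        (sq_nonneg _)
  have h2 : x ⬝ᵥ (B.mat *ᵥ x) ≤ B.eig i * (x ⬝ᵥ x) := by
    rw [key hB, key2 hV', Finset.mul_sum]
    refine Finset.sum_le_sum fun k _ => ?_
    by_cases h : e.symm k < i
    · have := hLx k h.ne
      simp only [h.not_gt, if_false] at this
      simp [this]
    · exact mul_le_mul_of_nonneg_right (B.isHermitian.eigenvalues₀_antitone (not_lt.mp h))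
        (sq_nonneg _)
  have h3 := dotProduct_mulVec_le (A - B) x
  rw [mat_sub, sub_mulVec, dotProduct_sub] at h3
  nlinarith

/-- `J` is the Moore–Penrose inverse of the symmetric matrix `A`. -/
structure IsPinv (A J : SymMat n) : Prop where
  mul_mul_self : A.mat * J.mat * A.mat = A.mat
  self_mul_mul : J.mat * A.mat * J.mat = J.mat
  comm : A.mat * J.mat = J.mat * A.mat

theorem exists_isPinv (A : SymMat n) {c : ℝ} (hc : 0 < c)
    (h : ∀ i, A.eig i ≠ 0 → c ≤ |A.eig i|) :
    ∃ J : SymMat n, A.IsPinv J ∧ ‖J‖ ≤ √(n * c⁻¹ ^ 2) ∧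
      (A.mat.PosSemidef → J.mat.PosSemidef) := by
  obtain ⟨U, hU, hU', hA⟩ := A.exists_diagonalization
  set d := A.isHermitian.eigenvalues with hd
  have hmul : ∀ f g : Fin n → ℝ, (U * diagonal f * Uᵀ) * (U * diagonal g * Uᵀ)
      = U * diagonal (fun i => f i * g i) * Uᵀ := by
    intro f g
    calc _ = U * diagonal f * (Uᵀ * U) * diagonal g * Uᵀ := by simp only [Matrix.mul_assoc]
      _ = U * (diagonal f * diagonal g) * Uᵀ := by rw [hU]; simp only [Matrix.mul_assoc, Matrix.mul_one]
      _ = _ := by rw [diagonal_mul_diagonal]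
  -- Since 0⁻¹ = 0, inverting the eigenvalues entrywise gives the pseudoinverse on the kernel as
  -- well.
  let J : SymMat n := ofMat (U * diagonal (fun i => (d i)⁻¹) * Uᵀ)
    (by simp [Matrix.mul_assoc])
  have hJ : J.mat = U * diagonal (fun i => (d i)⁻¹) * Uᵀ := rfl
  refine ⟨J, ⟨?_, ?_, ?_⟩, ?_, ?_⟩
  · rw [hJ, hA, hmul, hmul]; simp
  · rw [hJ, hA, hmul, hmul]
    have : (fun i => (d i)⁻¹ * d i * (d i)⁻¹) = fun i => (d i)⁻¹ := by
      funext i; simpa using mul_inv_mul_cancel (d i)⁻¹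
    rw [this]
  · rw [hJ, hA, hmul, hmul]; simp only [mul_comm]
  · rw [norm_eq_sqrt_real_inner, inner_eq_trace, hJ, hmul, trace_mul_comm, ← Matrix.mul_assoc, hU,
      Matrix.one_mul, trace_diagonal]
    refine Real.sqrt_le_sqrt ?_
    calc ∑ i, (d i)⁻¹ * (d i)⁻¹ ≤ ∑ _i : Fin n, c⁻¹ ^ 2 := by
          refine Finset.sum_le_sum fun i _ => ?_
          rw [← sq, ← sq_abs]
          refine pow_le_pow_left₀ (abs_nonneg _) ?_ 2
          by_cases hi : d i = 0
          · simp [hi, hc.le]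
          · rw [abs_inv]
            exact inv_anti₀ hc (h _ hi)
      _ = n * c⁻¹ ^ 2 := by simp
  · intro hpsd
    refine (PosSemidef.diagonal fun i => ?_).mul_mul_transpose U
    exact inv_nonneg.mpr (hpsd.eigenvalues_nonneg i)

theorem exists_isPinv_of_posSemidef (A : SymMat n) (hA : A.mat.PosSemidef) :
    ∃ J : SymMat n, A.IsPinv J ∧ J.mat.PosSemidef := by
  obtain ⟨c, hc, h⟩ : ∃ c > 0, ∀ i, A.eig i ≠ 0 → c ≤ |A.eig i| := by
    have := Filter.eventually_all.mpr fun i => show ∀ᶠ c in 𝓝[>] (0 : ℝ),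
        A.eig i ≠ 0 → c ≤ |A.eig i| by
      by_cases hi : A.eig i = 0
      · simp [hi]
      · filter_upwards [Ioo_mem_nhdsGT (abs_pos.mpr hi)] with c hc _ using hc.2.le
    obtain ⟨c, h1, h2⟩ := (this.and self_mem_nhdsWithin).exists
    exact ⟨c, h2, h1⟩
  obtain ⟨J, h1, -, h2⟩ := A.exists_isPinv hc h
  exact ⟨J, h1, h2 hA⟩

/-- Every symmetric matrix is the difference of two positive semidefinite ones whose product
vanishes. -/
theorem exists_posSemidef_add (A : SymMat n) :
    ∃ Z N : SymMat n, A = Z + N ∧ Z.mat.PosSemidef ∧ (-N.mat).PosSemidef ∧ Z.mat * N.mat = 0 := by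
  obtain ⟨U, hU, hU', hA⟩ := A.exists_diagonalization
  set d := A.isHermitian.eigenvalues with hd
  refine ⟨ofMat (U * diagonal (fun i => max (d i) 0) * Uᵀ) (by simp [Matrix.mul_assoc]),
    ofMat (U * diagonal (fun i => min (d i) 0) * Uᵀ) (by simp [Matrix.mul_assoc]), ?_, ?_, ?_, ?_⟩
  · refine mat_injective ?_
    rw [mat_add, mat_ofMat, mat_ofMat, ← Matrix.add_mul, ← Matrix.mul_add, diagonal_add, hA]
    simp only [max_add_min, add_zero]
  · exact (PosSemidef.diagonal fun i => le_max_right _ _).mul_mul_transpose U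
  · rw [mat_ofMat, ← Matrix.neg_mul, ← Matrix.mul_neg, diagonal_neg]
    exact (PosSemidef.diagonal fun i => neg_nonneg.mpr (min_le_right _ _)).mul_mul_transpose U
  · rw [mat_ofMat, mat_ofMat]
    calc _ = U * diagonal (fun i => max (d i) 0) * (Uᵀ * U) * diagonal (fun i => min (d i) 0) * Uᵀ := by
          simp only [Matrix.mul_assoc]
      _ = U * (diagonal (fun i => max (d i) 0) * diagonal (fun i => min (d i) 0)) * Uᵀ := by
          rw [hU]; simp only [Matrix.mul_assoc, Matrix.mul_one]
      _ = 0 := by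
          rw [diagonal_mul_diagonal]; simp

end SymMat

namespace SymMat

variable {n : ℕ} {X Γ J : SymMat n}

/-! ### The normal cone and the projection -/

/-- The test points X + xxᵀ give the sign of Γ; the points 0 and 2X give ⟨Γ,X⟩ = 0, which forces XΓ
= 0 for semidefinite matrices of opposite sign. -/
theorem posSemidef_of_mem_normalCone (h : Γ ∈ normalCone (psdCone n) X) :
    X.mat.PosSemidef ∧ (-Γ.mat).PosSemidef ∧ X.mat * Γ.mat = 0 := by
  obtain ⟨hX, h⟩ := h
  have hX' : X.mat.PosSemidef := hX
  have hΓ : (-Γ.mat).PosSemidef := by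
    rw [posSemidef_iff_dotProduct_mulVec]
    refine ⟨(-Γ).isHermitian, fun x => ?_⟩
    let B : SymMat n := ofMat (vecMulVec x x) (transpose_vecMulVec x x)
    have hB : B.mat.PosSemidef := by
      simpa [B] using posSemidef_vecMulVec_self_star x
    have h1 : inner ℝ Γ B = x ⬝ᵥ (Γ.mat *ᵥ x) := by
      rw [inner_def]
      simp only [B, mat_ofMat, vecMulVec_apply, dotProduct, mulVec, Finset.mul_sum]
      exact Finset.sum_congr rfl fun i _ => Finset.sum_congr rfl fun j _ => by ring
    have h2 := h (X + B) (hX'.add hB)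
    rw [add_sub_cancel_left, h1] at h2
    simpa [neg_mulVec] using h2
  refine ⟨hX', hΓ, ?_⟩
  have h0 := h 0 PosSemidef.zero
  have h2 := h (X + X) (hX'.add hX')
  rw [zero_sub, inner_neg_right] at h0
  rw [add_sub_cancel_left] at h2
  have h3 : inner ℝ Γ X = 0 := le_antisymm h2 (by linarith)
  have h4 := hX'.mul_eq_zero_of_trace_mul_eq_zero hΓ (by
    rw [Matrix.mul_neg, trace_neg, trace_mul_comm, ← inner_eq_trace, h3, neg_zero])
  simpa using h4

theorem mul_eq_zero_comm (h : X.mat * Γ.mat = 0) : Γ.mat * X.mat = 0 := by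
  simpa using congrArg transpose h

theorem inner_nonpos (hX : X.mat.PosSemidef) (hΓ : (-Γ.mat).PosSemidef) : inner ℝ X Γ ≤ 0 := by
  have := hX.trace_mul_nonneg hΓ
  rw [Matrix.mul_neg, trace_neg, ← inner_eq_trace] at this
  linarith

theorem inner_eq_zero (h : X.mat * Γ.mat = 0) : inner ℝ X Γ = 0 := by
  rw [inner_eq_trace, h, trace_zero]

/-- If `Y = X + Γ` with `X` positive semidefinite, `Γ` negative semidefinite and `X Γ = 0`, then
`X` is a nearest point of the cone of positive semidefinite matrices. -/
theorem norm_le_norm_sub (hΓ : (-Γ.mat).PosSemidef) (h : X.mat * Γ.mat = 0) {Z : SymMat n}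
    (hZ : Z.mat.PosSemidef) : ‖Γ‖ ≤ ‖Z - (X + Γ)‖ := by
  have h1 : ‖Z - (X + Γ)‖ ^ 2 = ‖Z - X‖ ^ 2 - 2 * inner ℝ (Z - X) Γ + ‖Γ‖ ^ 2 := by
    rw [← sub_sub, norm_sub_sq_real]
  rw [inner_sub_left, inner_eq_zero h] at h1
  have h2 := inner_nonpos hZ hΓ
  refine (sq_le_sq₀ (norm_nonneg _) (norm_nonneg _)).mp ?_
  linarith [sq_nonneg ‖Z - X‖]

theorem moreauEnv_one_indicator (hX : X.mat.PosSemidef) (hΓ : (-Γ.mat).PosSemidef)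
    (h : X.mat * Γ.mat = 0) :
    moreauEnv 1 (convIndicator (psdCone n)) (X + Γ) = ((1 / 2 * ‖Γ‖ ^ 2 : ℝ) : EReal) := by
  refine le_antisymm ?_ (le_iInf fun Z => ?_)
  · refine (iInf_le _ X).trans ?_
    have hX' : X ∈ psdCone n := hX
    rw [convIndicator, if_pos hX', zero_add, sub_add_cancel_left, norm_neg]
    norm_num
  · by_cases hZ : Z ∈ psdCone n
    · rw [convIndicator, if_pos hZ, zero_add, EReal.coe_le_coe_iff]
      have := pow_le_pow_left₀ (norm_nonneg _) (norm_le_norm_sub hΓ h hZ) 2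
      linarith
    · rw [convIndicator, if_neg hZ, EReal.top_add_coe]
      exact le_top

theorem metricProj_nsdCone (hX : X.mat.PosSemidef) (hΓ : (-Γ.mat).PosSemidef)
    (h : X.mat * Γ.mat = 0) : metricProj (nsdCone n) (X + Γ) = Γ := by
  -- This Pythagorean inequality gives both minimality and uniqueness; uniqueness identifies the
  -- point chosen by `Classical.epsilon`.
  have key : ∀ z ∈ nsdCone n, ‖X‖ ^ 2 + ‖Γ - z‖ ^ 2 ≤ ‖X + Γ - z‖ ^ 2 := by
    intro z hz
    have h2 := inner_nonpos hX hz
    rw [add_sub_assoc, norm_add_sq_real, inner_sub_right, inner_eq_zero h]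
    linarith
  have hex : Γ ∈ nsdCone n ∧ ∀ z ∈ nsdCone n, ‖X + Γ - Γ‖ ≤ ‖X + Γ - z‖ := by
    refine ⟨hΓ, fun z hz => ?_⟩
    rw [add_sub_cancel_right]
    refine (sq_le_sq₀ (norm_nonneg _) (norm_nonneg _)).mp ?_
    linarith [key z hz, sq_nonneg ‖Γ - z‖]
  obtain ⟨hp, hmin⟩ := Classical.epsilon_spec (p := fun x : SymMat n =>
    x ∈ nsdCone n ∧ ∀ z ∈ nsdCone n, ‖X + Γ - x‖ ≤ ‖X + Γ - z‖) ⟨Γ, hex⟩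
  have h1 := key _ hp
  have h2 := pow_le_pow_left₀ (norm_nonneg _) (hmin Γ hΓ) 2
  rw [add_sub_cancel_right] at h2
  have h3 : ‖Γ - metricProj (nsdCone n) (X + Γ)‖ ^ 2 ≤ 0 := by
    unfold metricProj
    linarith
  have h4 : ‖Γ - metricProj (nsdCone n) (X + Γ)‖ = 0 := by
    have := le_antisymm h3 (sq_nonneg _)
    simpa using this
  exact (sub_eq_zero.mp (norm_eq_zero.mp h4)).symm

/-! ### Second-order estimates at a positive semidefinite matrix -/

/-- The curvature term `-⟨Γ, W J W⟩`. -/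
noncomputable def curvature (Γ J W : SymMat n) : ℝ :=
  -(Γ.mat * (W.mat * J.mat * W.mat)).trace

/-- The second-order correction that turns a tangent direction into an admissible one. -/
noncomputable def correction (X J W : SymMat n) : SymMat n :=
  ofMat ((1 - (1 / 2 : ℝ) • (J.mat * X.mat)) * (W.mat * J.mat * W.mat) *
    (1 - (1 / 2 : ℝ) • (X.mat * J.mat))) (by simp [Matrix.mul_assoc])

/-- Tangency of `W` to the cone of positive semidefinite matrices at `X`. -/
def IsTangent (X J W : SymMat n) : Prop :=
  ((1 - X.mat * J.mat) * W.mat * (1 - X.mat * J.mat)ᵀ).PosSemidef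

theorem norm_correction_le (W : SymMat n) :
    ‖correction X J W‖ ≤ ‖1 - (1 / 2 : ℝ) • (J.mat * X.mat)‖ * ‖J‖ *
      ‖1 - (1 / 2 : ℝ) • (X.mat * J.mat)‖ * ‖W‖ ^ 2 := by
  rw [← norm_mat, correction, mat_ofMat]
  calc _ ≤ ‖1 - (1 / 2 : ℝ) • (J.mat * X.mat)‖ * (‖W.mat‖ * ‖J.mat‖ * ‖W.mat‖) *
        ‖1 - (1 / 2 : ℝ) • (X.mat * J.mat)‖ := by
        refine (norm_mul_le _ _).trans ?_
        gcongr
        refine (norm_mul_le _ _).trans ?_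
        gcongr
        refine (norm_mul_le _ _).trans ?_
        gcongr
        exact norm_mul_le _ _
    _ = _ := by rw [norm_mat, norm_mat]; ring

namespace IsPinv

theorem comp_mul_self (hJ : X.IsPinv J) : (1 - X.mat * J.mat) * X.mat = 0 := by
  rw [Matrix.sub_mul, hJ.mul_mul_self, Matrix.one_mul, sub_self]

theorem isTangent (hJ : X.IsPinv J) {W : SymMat n} (h : (X.mat + W.mat).PosSemidef) :
    IsTangent X J W := by
  have := h.mul_mul_transpose (1 - X.mat * J.mat)
  rwa [Matrix.mul_add, hJ.comp_mul_self, zero_add] at this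

/-- With P = XJ and L = 1 − P/2, the sum is (1 + LWJ) X (1 + LWJ)ᵀ + (1 − P) W (1 − P)ᵀ. The factor
½ in L splits the PWP block evenly between the two cross terms. -/
theorem posSemidef_add_correction (hJ : X.IsPinv J) (hX : X.mat.PosSemidef) {W : SymMat n}
    (hW : IsTangent X J W) : (X.mat + W.mat + (correction X J W).mat).PosSemidef := by
  set P := X.mat * J.mat with hP
  set L : Matrix (Fin n) (Fin n) ℝ := 1 - (1 / 2 : ℝ) • P with hL
  have hPt : Pᵀ = P := by rw [hP, transpose_mul, mat_transpose, mat_transpose, hJ.comm]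
  have hLt : Lᵀ = L := by simp [hL, hPt]
  have hT : (correction X J W).mat = L * (W.mat * J.mat * W.mat) * L := by
    rw [correction, mat_ofMat, ← hJ.comm]
  have h1 := (hX.mul_mul_transpose (1 + L * W.mat * J.mat)).add hW
  have h2 : (1 + L * W.mat * J.mat) * X.mat * (1 + L * W.mat * J.mat)ᵀ
      = X.mat + L * W.mat * P + P * W.mat * L + L * (W.mat * J.mat * W.mat) * L := by
    rw [transpose_add, transpose_mul, transpose_mul, hLt, mat_transpose, mat_transpose,
      transpose_one]
    have e1 : (1 + L * W.mat * J.mat) * X.mat * (1 + J.mat * (W.mat * L))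
        = X.mat + L * W.mat * (J.mat * X.mat) + (X.mat * J.mat) * W.mat * L
          + L * (W.mat * (J.mat * X.mat * J.mat) * W.mat) * L := by noncomm_ring
    rw [e1, hJ.self_mul_mul, ← hJ.comm]
  have h3 : L * W.mat * P + P * W.mat * L + (1 - P) * W.mat * (1 - P)ᵀ = W.mat := by
    rw [transpose_sub, transpose_one, hPt, hL]
    simp only [Matrix.mul_sub, Matrix.sub_mul, Matrix.mul_one, Matrix.one_mul, Matrix.smul_mul,
      Matrix.mul_smul, Matrix.mul_assoc]
    module
  rw [h2] at h1
  convert h1 using 1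
  rw [hT]
  nth_rewrite 1 [← h3]
  abel

theorem trace_mul_correction (hJ : X.IsPinv J) (hXΓ : X.mat * Γ.mat = 0) (W : SymMat n) :
    (Γ.mat * (correction X J W).mat).trace = -curvature Γ J W := by
  have h1 : Γ.mat * (1 - (1 / 2 : ℝ) • (J.mat * X.mat)) = Γ.mat := by
    simp [Matrix.mul_sub, ← hJ.comm, ← Matrix.mul_assoc, mul_eq_zero_comm hXΓ]
  have h2 : (1 - (1 / 2 : ℝ) • (X.mat * J.mat)) * Γ.mat = Γ.mat := by
    simp [Matrix.sub_mul, hJ.comm, Matrix.mul_assoc, hXΓ]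
  rw [correction, mat_ofMat, curvature, neg_neg, ← Matrix.mul_assoc, trace_mul_comm,
    ← Matrix.mul_assoc, ← Matrix.mul_assoc, h2, h1]

/-- An approximate Schur complement: congruence by 1 − WJ turns X + W into a matrix whose pairing
with Γ involves only W, WJW and a cubic remainder. Pairing with −Γ ⪰ 0 gives the inequality. -/
theorem curvature_add_le (hJ : X.IsPinv J) (hΓ : (-Γ.mat).PosSemidef) (hXΓ : X.mat * Γ.mat = 0)
    {W : SymMat n} (h : (X.mat + W.mat).PosSemidef) :
    curvature Γ J W + (Γ.mat * (W.mat * J.mat * W.mat * J.mat * W.mat)).trace ≤ -inner ℝ Γ W := by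
  have h1 := hΓ.trace_mul_nonneg (h.mul_mul_transpose (1 - W.mat * J.mat))
  have h2 : (1 - W.mat * J.mat) * (X.mat + W.mat) * (1 - W.mat * J.mat)ᵀ
      = X.mat * (1 - J.mat * W.mat) + W.mat - W.mat * J.mat * X.mat - W.mat * J.mat * W.mat
        + W.mat * J.mat * W.mat * J.mat * W.mat := by
    rw [transpose_sub, transpose_mul, mat_transpose, mat_transpose, transpose_one]
    have e1 : (1 - W.mat * J.mat) * (X.mat + W.mat) * (1 - J.mat * W.mat)
        = X.mat * (1 - J.mat * W.mat) + W.mat - W.mat * J.mat * X.mat - 2 • (W.mat * J.mat * W.mat)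
        + W.mat * J.mat * W.mat * J.mat * W.mat + W.mat * (J.mat * X.mat * J.mat) * W.mat := by
      noncomm_ring
    rw [e1, hJ.self_mul_mul]
    noncomm_ring
  have h3 : (Γ.mat * (X.mat * (1 - J.mat * W.mat))).trace = 0 := by
    rw [← Matrix.mul_assoc, mul_eq_zero_comm hXΓ, Matrix.zero_mul, trace_zero]
  have h4 : (Γ.mat * (W.mat * J.mat * X.mat)).trace = 0 := by
    rw [← Matrix.mul_assoc, trace_mul_comm, ← Matrix.mul_assoc, hXΓ, Matrix.zero_mul, trace_zero]
  rw [h2, Matrix.neg_mul, trace_neg, Matrix.mul_add, Matrix.mul_sub, Matrix.mul_sub,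
    Matrix.mul_add, trace_add, trace_sub, trace_sub, trace_add, h3, h4] at h1
  rw [curvature, inner_eq_trace]
  linarith

end IsPinv

/-- As ΓX = 0, the projection 1 − XJ can be inserted on both sides of W without changing ⟨Γ,W⟩. -/
theorem inner_nonpos_of_isTangent (hΓ : (-Γ.mat).PosSemidef)
    (hXΓ : X.mat * Γ.mat = 0) {W : SymMat n} (h : IsTangent X J W) : inner ℝ Γ W ≤ 0 := by
  have h1 := hΓ.trace_mul_nonneg h
  have h2 : Γ.mat * (1 - X.mat * J.mat) = Γ.mat := by
    simp [Matrix.mul_sub, ← Matrix.mul_assoc, mul_eq_zero_comm hXΓ]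
  have h3 : (1 - X.mat * J.mat)ᵀ * Γ.mat = Γ.mat := by simpa using congrArg transpose h2
  rw [Matrix.neg_mul, trace_neg, ← Matrix.mul_assoc, trace_mul_comm, ← Matrix.mul_assoc,
    ← Matrix.mul_assoc, h3, h2] at h1
  rw [inner_eq_trace]
  linarith

/-! ### The second subderivative of the indicator function -/

theorem secondSubderiv_le (hJ : X.IsPinv J) (hX : X.mat.PosSemidef) (hXΓ : X.mat * Γ.mat = 0)
    {W : SymMat n} (hW : IsTangent X J W) (hΓW : inner ℝ Γ W = 0) :
    secondSubderiv (convIndicator (psdCone n)) X Γ W ≤ ((2 * curvature Γ J W : ℝ) : EReal) := by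
  refine liminf_le_of_frequently_le' ?_
  -- The correction T is quadratic in W, so X + tW + t²T stays in the cone. Along this arc the
  -- difference quotient is exactly twice the curvature.
  have ht : Tendsto (fun t : ℝ => (t, W + t • correction X J W)) (𝓝[>] 0)
      (𝓝[>] (0 : ℝ) ×ˢ 𝓝 W) := by
    refine tendsto_id.prodMk ?_
    have : Continuous fun t : ℝ => W + t • correction X J W := by fun_prop
    have h := this.tendsto 0
    rw [zero_smul, add_zero] at h
    exact h.mono_left nhdsWithin_le_nhds
  refine ht.frequently (Eventually.frequently ?_)
  filter_upwards [self_mem_nhdsWithin] with t ht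
  have ht : 0 < t := ht
  have hc : (correction X J (t • W)).mat = t • t • (correction X J W).mat := by
    simp only [correction, mat_ofMat, mat_smul, Matrix.smul_mul, Matrix.mul_smul]
  have hmem : X + t • (W + t • correction X J W) ∈ psdCone n := by
    have htan : IsTangent X J (t • W) := by
      have := PosSemidef.smul hW ht.le
      simpa [IsTangent] using this
    have := hJ.posSemidef_add_correction hX htan
    rw [hc] at this
    show PosSemidef _
    simpa [smul_add, add_assoc] using this
  have hX' : X ∈ psdCone n := hX
  have hin : inner ℝ Γ (W + t • correction X J W) = -(t * curvature Γ J W) := by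
    rw [inner_add_right, hΓW, inner_smul_right, inner_eq_trace, hJ.trace_mul_correction hXΓ]
    ring
  simp only [convIndicator, if_pos hmem, if_pos hX', hin]
  rw [sub_zero, zero_sub, ← EReal.coe_neg, ← EReal.coe_div, EReal.coe_le_coe_iff]
  refine le_of_eq ?_
  field_simp

/-- A finite quotient forces feasibility. The three consequences are rescaled to be closed
conditions in (t, V), so they survive the limit t ↓ 0, V → W. -/
theorem of_quotient_lt (hJ : X.IsPinv J) (hX : X.mat.PosSemidef) (hΓ : (-Γ.mat).PosSemidef)
    (hXΓ : X.mat * Γ.mat = 0) {t c : ℝ} (ht : 0 < t) {V : SymMat n}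
    (hlt : (convIndicator (psdCone n) (X + t • V) - convIndicator (psdCone n) X -
      ((t * inner ℝ Γ V : ℝ) : EReal)) / ((t ^ 2 / 2 : ℝ) : EReal) < (c : EReal)) :
    IsTangent X J V ∧ -inner ℝ Γ V - t * c / 2 ≤ 0 ∧
      2 * curvature Γ J V + 2 * t * (Γ.mat * (V.mat * J.mat * V.mat * J.mat * V.mat)).trace
        ≤ c := by
  have hX' : X ∈ psdCone n := hX
  by_cases hmem : X + t • V ∈ psdCone n
  · simp only [convIndicator, if_pos hmem, if_pos hX'] at hlt
    rw [sub_zero, zero_sub, ← EReal.coe_neg, ← EReal.coe_div, EReal.coe_lt_coe_iff,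
      div_lt_iff₀ (by positivity)] at hlt
    have hpsd : (X.mat + (t • V).mat).PosSemidef := hmem
    have h1 := hJ.isTangent hpsd
    have h2 := hJ.curvature_add_le hΓ hXΓ hpsd
    simp only [curvature, mat_smul, Matrix.smul_mul, Matrix.mul_smul, trace_smul, smul_eq_mul,
      inner_smul_right] at h2
    refine ⟨?_, ?_, ?_⟩
    · have := PosSemidef.smul h1 (inv_nonneg.mpr ht.le)
      simpa [IsTangent, ht.ne'] using this
    · refine le_of_mul_le_mul_left ?_ ht
      linarith
    · refine le_of_mul_le_mul_left ?_ (show 0 < t ^ 2 / 2 by positivity)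
      rw [curvature]
      linarith
  · simp only [convIndicator, if_neg hmem, if_pos hX'] at hlt
    rw [sub_zero, EReal.top_sub_coe, EReal.top_div_of_pos_ne_top] at hlt
    · exact absurd hlt not_top_lt
    · exact_mod_cast (by positivity : 0 < t ^ 2 / 2)
    · exact EReal.coe_ne_top _

theorem of_secondSubderiv_lt (hJ : X.IsPinv J) (hX : X.mat.PosSemidef) (hΓ : (-Γ.mat).PosSemidef)
    (hXΓ : X.mat * Γ.mat = 0) {W : SymMat n} {c : ℝ}
    (h : secondSubderiv (convIndicator (psdCone n)) X Γ W < (c : EReal)) :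
    IsTangent X J W ∧ inner ℝ Γ W = 0 ∧ 2 * curvature Γ J W ≤ c := by
  have hfr := (frequently_lt_of_liminf_lt (by isBoundedDefault) h).and_eventually
    (show ∀ᶠ p : ℝ × SymMat n in 𝓝[>] (0 : ℝ) ×ˢ 𝓝 W, 0 < p.1 from
      tendsto_fst.eventually self_mem_nhdsWithin)
  have hfr2 : ∃ᶠ p : ℝ × SymMat n in 𝓝[>] (0 : ℝ) ×ˢ 𝓝 W, IsTangent X J p.2 ∧
      -inner ℝ Γ p.2 - p.1 * c / 2 ≤ 0 ∧
      2 * curvature Γ J p.2 + 2 * p.1 * (Γ.mat * (p.2.mat * J.mat * p.2.mat * J.mat * p.2.mat)).trace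
        ≤ c := by
    exact hfr.mono fun p hp => of_quotient_lt hJ hX hΓ hXΓ hp.2 hp.1
  have hle : 𝓝[>] (0 : ℝ) ×ˢ 𝓝 W ≤ 𝓝 ((0 : ℝ), W) := by
    rw [nhds_prod_eq]
    exact Filter.prod_mono nhdsWithin_le_nhds le_rfl
  have hm : Continuous fun p : ℝ × SymMat n => p.2.mat := continuous_mat.comp continuous_snd
  have htan : IsTangent X J W := by
    have hcont : Continuous fun p : ℝ × SymMat n =>
        (1 - X.mat * J.mat) * p.2.mat * (1 - X.mat * J.mat)ᵀ := by fun_prop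
    exact isClosed_posSemidef.mem_of_frequently_of_tendsto (hfr2.mono fun p hp => hp.1)
      ((hcont.tendsto _).mono_left hle)
  refine ⟨htan, le_antisymm (inner_nonpos_of_isTangent hΓ hXΓ htan) ?_, ?_⟩
  · have hcont : Continuous fun p : ℝ × SymMat n => -inner ℝ Γ p.2 - p.1 * c / 2 := by fun_prop
    have := le_of_tendsto_of_frequently ((hcont.tendsto _).mono_left hle)
      (hfr2.mono fun p hp => hp.2.1)
    simp only at this
    linarith
  · have hcont : Continuous fun p : ℝ × SymMat n => 2 * curvature Γ J p.2 + 2 * p.1 *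
        (Γ.mat * (p.2.mat * J.mat * p.2.mat * J.mat * p.2.mat)).trace := by
      unfold curvature
      fun_prop
    have := le_of_tendsto_of_frequently ((hcont.tendsto _).mono_left hle)
      (hfr2.mono fun p hp => hp.2.2)
    simpa using this

end SymMat

namespace SymMat

variable {n : ℕ} {X Γ J D H Z N : SymMat n}

/-! ### Comparison of the two Moreau envelopes -/

/-- Testing against real c above f W avoids infinite values; for ρ = ½ the penalty has coefficient
1. -/
theorem le_moreauEnv_half_of_forall {f : SymMat n → EReal} {v : ℝ}
    (h : ∀ W : SymMat n, ∀ c : ℝ, f W < (c : EReal) → v ≤ c + ‖W - H‖ ^ 2) :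
    (v : EReal) ≤ moreauEnv (1 / 2) f H := by
  refine le_iInf fun W => ?_
  by_contra! hlt
  have h1 : f W < ((v - 1 / (2 * (1 / 2)) * ‖W - H‖ ^ 2 : ℝ) : EReal) := by
    rw [EReal.coe_sub]
    exact EReal.lt_sub_iff_add_lt (.inl (EReal.coe_ne_bot _)) (.inl (EReal.coe_ne_top _)) |>.mpr hlt
  obtain ⟨c, hc1, hc2⟩ := EReal.lt_iff_exists_real_btwn.mp h1
  have h2 := h W c hc1
  have h3 := EReal.coe_lt_coe_iff.mp hc2
  norm_num at h3
  linarith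

theorem le_moreauEnv_secondSubderiv (hJ : X.IsPinv J) (hX : X.mat.PosSemidef)
    (hΓ : (-Γ.mat).PosSemidef) (hXΓ : X.mat * Γ.mat = 0) (hJp : J.mat.PosSemidef)
    (hN : (-N.mat).PosSemidef) (hZN : Z.mat * N.mat = 0) (hsum : X + Γ + H = Z + N)
    {k : ℝ} (hk0 : 0 ≤ k) (hk : ∀ W, ‖correction X J W‖ ≤ k * ‖W‖ ^ 2) (hH : ‖H‖ ≤ 1) :
    ((‖N‖ ^ 2 - ‖Γ‖ ^ 2 - 2 * inner ℝ Γ H - (8 * k + 16 * k ^ 2) * ‖H‖ ^ 3 : ℝ) : EReal) ≤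
      moreauEnv (1 / 2) (secondSubderiv (convIndicator (psdCone n)) X Γ) H := by
  refine le_moreauEnv_half_of_forall fun W c hc => ?_
  obtain ⟨htan, hΓW, hcurv⟩ := of_secondSubderiv_lt hJ hX hΓ hXΓ hc
  have hH3 : 0 ≤ (8 * k + 16 * k ^ 2) * ‖H‖ ^ 3 := by positivity
  -- Z is nearest to A + H in the cone, so every feasible V bounds m from above.
  have hbound : ∀ {V : SymMat n}, (X.mat + V.mat).PosSemidef →
      ‖N‖ ^ 2 - ‖Γ‖ ^ 2 - 2 * inner ℝ Γ H ≤ ‖V - H‖ ^ 2 - 2 * inner ℝ Γ V := by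
    intro V hV
    have h1 : ‖N‖ ≤ ‖(X + V) - (Z + N)‖ := norm_le_norm_sub hN hZN hV
    have h2 : (X + V) - (Z + N) = (V - H) - Γ := by rw [← hsum]; abel
    rw [h2] at h1
    have h3 := pow_le_pow_left₀ (norm_nonneg _) h1 2
    rw [norm_sub_sq_real, real_inner_comm, inner_sub_right] at h3
    linarith
  have hcurv0 : 0 ≤ curvature Γ J W := by
    have := hΓ.trace_mul_nonneg (hJp.mul_mul_transpose W.mat)
    rw [mat_transpose, Matrix.neg_mul, trace_neg] at this
    exact this
  -- If W does no better than 0, the competitor V = 0 suffices. Otherwise nonnegative curvature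
  -- gives ‖W‖ ≤ 2‖H‖, and V = W + T is used.
  by_cases hs : ‖H‖ ^ 2 ≤ c + ‖W - H‖ ^ 2
  · have h0 := hbound (V := 0) (by simpa using hX)
    simp only [zero_sub, norm_neg, inner_zero_right] at h0
    linarith
  · have hWH : ‖W - H‖ ≤ ‖H‖ := by
      refine (sq_le_sq₀ (norm_nonneg _) (norm_nonneg _)).mp ?_
      linarith
    have hW : ‖W‖ ≤ 2 * ‖H‖ := by
      have := norm_add_le (W - H) H
      rw [sub_add_cancel] at this
      linarith
    set T := correction X J W with hT
    have hTn : ‖T‖ ≤ 4 * k * ‖H‖ ^ 2 := by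
      calc ‖T‖ ≤ k * ‖W‖ ^ 2 := hk W
        _ ≤ k * (2 * ‖H‖) ^ 2 := by gcongr
        _ = _ := by ring
    have h1 := hbound (V := W + T) (by
      rw [mat_add, ← add_assoc]; exact hJ.posSemidef_add_correction hX htan)
    rw [inner_add_right, hΓW, inner_eq_trace Γ T, hJ.trace_mul_correction hXΓ] at h1
    have h2 : ‖W + T - H‖ ^ 2 ≤ ‖W - H‖ ^ 2 + 8 * k * ‖H‖ ^ 3 + 16 * k ^ 2 * ‖H‖ ^ 3 := by
      have e : W + T - H = (W - H) + T := by abel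
      calc ‖W + T - H‖ ^ 2 ≤ (‖W - H‖ + ‖T‖) ^ 2 := by rw [e]; gcongr; exact norm_add_le _ _
        _ = ‖W - H‖ ^ 2 + 2 * (‖W - H‖ * ‖T‖) + ‖T‖ ^ 2 := by ring
        _ ≤ ‖W - H‖ ^ 2 + 2 * (‖H‖ * (4 * k * ‖H‖ ^ 2)) + (4 * k * ‖H‖ ^ 2) ^ 2 := by gcongr
        _ = ‖W - H‖ ^ 2 + 8 * k * ‖H‖ ^ 3 + 16 * k ^ 2 * (‖H‖ ^ 3 * ‖H‖) := by ring
        _ ≤ _ := by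
          gcongr
          exact mul_le_of_le_one_right (by positivity) hH
    linarith

/-- The direction `W` with its components in the range of `Γ` removed is critical and has the same
curvature. -/
theorem exists_critical_near (hJ : X.IsPinv J) (hD : Γ.IsPinv D) (hXΓ : X.mat * Γ.mat = 0)
    {W : SymMat n} (hW : (X.mat + W.mat).PosSemidef) :
    ∃ R : SymMat n, IsTangent X J (W - R) ∧ inner ℝ Γ (W - R) = 0 ∧
      curvature Γ J (W - R) = curvature Γ J W ∧
      ‖R‖ ≤ (2 + ‖Γ‖ * ‖D‖) * ‖(1 - X.mat * J.mat) * W.mat * Γ.mat * D.mat‖ := by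
  set p := X.mat * J.mat with hp
  set s := Γ.mat * D.mat with hs
  clear_value p s
  have hpt : pᵀ = p := by rw [hp, transpose_mul, mat_transpose, mat_transpose, hJ.comm]
  have hst : sᵀ = s := by rw [hs, transpose_mul, mat_transpose, mat_transpose, hD.comm]
  have hΓX := mul_eq_zero_comm hXΓ
  have hps : p * s = 0 := by
    rw [hp, hJ.comm, hs, Matrix.mul_assoc, ← Matrix.mul_assoc X.mat, hXΓ]; simp
  have hsp : s * p = 0 := by
    rw [hs, hD.comm, hp, Matrix.mul_assoc, ← Matrix.mul_assoc Γ.mat, hΓX]; simp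
  have hΓs : Γ.mat * s = Γ.mat := by
    rw [hs, hD.comm, ← Matrix.mul_assoc, hD.mul_mul_self]
  have hsJ : s * J.mat = 0 := by
    calc s * J.mat = s * p * J.mat := by
          rw [Matrix.mul_assoc, hp, hJ.comm, hJ.self_mul_mul]
      _ = 0 := by rw [hsp, Matrix.zero_mul]
  have hJs : J.mat * s = 0 := by
    have := congrArg transpose hsJ
    rwa [transpose_mul, mat_transpose, hst, transpose_zero] at this
  have hpp : p * p = p := by
    rw [hp, ← Matrix.mul_assoc, hJ.mul_mul_self]
  have hpΓ : p * Γ.mat = 0 := by rw [hp, hJ.comm, Matrix.mul_assoc, hXΓ, Matrix.mul_zero]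
  set V := (1 - p) * W.mat * s with hV
  clear_value V
  have hVt : Vᵀ = s * W.mat * (1 - p) := by
    rw [hV, transpose_mul, transpose_mul, transpose_sub, transpose_one, hpt, hst, mat_transpose,
      Matrix.mul_assoc]
  have hsV : s * V = s * W.mat * s := by
    rw [hV, ← Matrix.mul_assoc, ← Matrix.mul_assoc, Matrix.mul_sub, hsp, sub_zero, Matrix.mul_one]
  -- With p and s the projections onto the ranges of X and Γ, R collects the blocks of (1 − p)W(1 −
  -- p) that meet the range of s; sV is the block counted twice. The p–s blocks remain in W, since
  -- they carry curvature.
  let R : SymMat n := ofMat (V + Vᵀ - s * V) (by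
    rw [hsV]
    simp only [transpose_sub, transpose_add, transpose_transpose, transpose_mul, hst,
      mat_transpose, Matrix.mul_assoc]
    rw [add_comm])
  have hR : R.mat = V + Vᵀ - s * V := rfl
  have hVJ : V * J.mat = 0 := by rw [hV, Matrix.mul_assoc, hsJ, Matrix.mul_zero]
  have hJp : J.mat * (1 - p) = 0 := by
    rw [Matrix.mul_sub, Matrix.mul_one, hp, ← Matrix.mul_assoc, hJ.self_mul_mul, sub_self]
  have hpJ : (1 - p) * J.mat = 0 := by
    have := congrArg transpose hJp
    rwa [transpose_mul, transpose_sub, transpose_one, hpt, mat_transpose, transpose_zero] at this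
  have hRJ : R.mat * J.mat = 0 := by
    rw [hR, Matrix.sub_mul, Matrix.add_mul, hVJ, Matrix.mul_assoc, hVJ, hVt, Matrix.mul_assoc, hpJ]
    simp
  have hJR : J.mat * R.mat = 0 := mul_eq_zero_comm (X := R) (Γ := J) hRJ
  refine ⟨R, ?_, ?_, ?_, ?_⟩
  -- Compressing W − R by 1 − p equals compressing X + W by 1 − p − s.
  · have h1 := hW.mul_mul_transpose (1 - p - s)
    have h2 : (1 - p - s) * (X.mat + W.mat) * (1 - p - s)ᵀ
        = (1 - p) * (W - R).mat * (1 - p)ᵀ := by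
      have e0 : (1 - p - s) * X.mat = 0 := by
        rw [Matrix.sub_mul, hp, hJ.comp_mul_self, hs, hD.comm, Matrix.mul_assoc, hΓX]; simp
      have e1 : (1 - p) * (1 - p) = 1 - p := by
        rw [Matrix.mul_sub, Matrix.mul_one, Matrix.sub_mul, hpp]; simp
      have e2 : (1 - p) * s = s := by rw [Matrix.sub_mul, hps]; simp
      have e3 : s * (1 - p) = s := by rw [Matrix.mul_sub, hsp]; simp
      rw [Matrix.mul_add, e0, zero_add, transpose_sub, transpose_sub, transpose_one, hpt, hst,
        mat_sub, hR, hsV, hVt, hV]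
      set c := 1 - p
      have e4 : c * (W.mat - (c * W.mat * s + s * W.mat * c - s * W.mat * s)) * c
          = c * W.mat * c - (c * c) * W.mat * (s * c) - (c * s) * W.mat * (c * c)
            + (c * s) * W.mat * (s * c) := by noncomm_ring
      rw [e4, e1, e2, e3]
      noncomm_ring
    rw [h2, hp] at h1
    exact h1
  · rw [inner_sub_right, inner_eq_trace, inner_eq_trace, hR, Matrix.mul_sub, Matrix.mul_add,
      ← Matrix.mul_assoc, hΓs, add_sub_cancel_left, hVt, ← Matrix.mul_assoc, ← Matrix.mul_assoc,
      hΓs, Matrix.mul_sub, Matrix.mul_one, trace_sub, trace_mul_comm (Γ.mat * W.mat) p,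
      ← Matrix.mul_assoc, hpΓ, Matrix.zero_mul, trace_zero]
    ring
  · rw [curvature, curvature, mat_sub]
    have : (W.mat - R.mat) * J.mat * (W.mat - R.mat) = W.mat * J.mat * W.mat := by
      rw [Matrix.sub_mul, hRJ, sub_zero, Matrix.mul_sub, Matrix.mul_assoc _ _ R.mat, hJR,
        Matrix.mul_zero, sub_zero]
    rw [this]
  · have hs' : ‖s‖ ≤ ‖Γ‖ * ‖D‖ := by
      rw [hs, ← norm_mat Γ, ← norm_mat D]; exact norm_mul_le _ _
    have hVe : (1 - p) * W.mat * Γ.mat * D.mat = V := by rw [Matrix.mul_assoc, ← hs, hV]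
    rw [hVe, ← norm_mat, hR]
    calc ‖V + Vᵀ - s * V‖ ≤ ‖V‖ + ‖Vᵀ‖ + ‖s * V‖ :=
          (norm_sub_le _ _).trans (add_le_add_left (norm_add_le _ _) _)
      _ ≤ ‖V‖ + ‖V‖ + ‖Γ‖ * ‖D‖ * ‖V‖ := by
          rw [frobenius_norm_transpose]
          gcongr
          exact (norm_mul_le _ _).trans (by gcongr)
      _ = _ := by ring

/-- The test direction is W − R with W = Z − X. For this W, m = ‖H − W‖² − 2⟨Γ,W⟩, and
`curvature_add_le` compares the linear term with the curvature. -/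
theorem moreauEnv_secondSubderiv_le (hJ : X.IsPinv J) (hX : X.mat.PosSemidef)
    (hΓ : (-Γ.mat).PosSemidef) (hXΓ : X.mat * Γ.mat = 0) (hD : Γ.IsPinv D)
    (hZ : Z.mat.PosSemidef) (hN : (-N.mat).PosSemidef) (hZN : Z.mat * N.mat = 0)
    (hsum : X + Γ + H = Z + N) {g d ρ : ℝ} (hg : ‖Γ‖ ≤ g) (hd : ‖D‖ ≤ d)
    (hρ : ρ = (2 + g * d) * (‖1 - X.mat * J.mat‖ * d)) (hH : ‖H‖ ≤ 1) :
    moreauEnv (1 / 2) (secondSubderiv (convIndicator (psdCone n)) X Γ) H ≤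
      ((‖N‖ ^ 2 - ‖Γ‖ ^ 2 - 2 * inner ℝ Γ H +
        (2 * ρ + ρ ^ 2 + 2 * (g * ‖J‖ ^ 2)) * ‖H‖ ^ 3 : ℝ) : EReal) := by
  have hg0 : 0 ≤ g := (norm_nonneg _).trans hg
  have hd0 : 0 ≤ d := (norm_nonneg _).trans hd
  have hρ0 : 0 ≤ ρ := by rw [hρ]; positivity
  obtain ⟨W, rfl⟩ : ∃ W, Z = X + W := ⟨Z - X, by abel⟩
  obtain rfl : N = Γ + (H - W) := by
    have : N = X + Γ + H - (X + W) := by rw [hsum]; abel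
    rw [this]; abel
  -- Monotonicity of the normal cone mapping, as H − W = N − Γ; hence ‖W‖ and ‖H − W‖ are at most
  -- ‖H‖.
  have hmono : 0 ≤ inner ℝ W (H - W) := by
    have h1 := inner_nonpos hX hN
    have h2 := inner_nonpos hZ hΓ
    have h3 := inner_eq_zero hZN
    have h4 := inner_eq_zero hXΓ
    rw [inner_add_right] at h1
    rw [inner_add_left] at h2
    rw [inner_add_left, inner_add_right, inner_add_right] at h3
    linarith
  have hHsq : ‖H‖ ^ 2 = ‖W‖ ^ 2 + 2 * inner ℝ W (H - W) + ‖H - W‖ ^ 2 := by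
    rw [← norm_add_sq_real, add_sub_cancel]
  have hWH : ‖W‖ ≤ ‖H‖ := by
    refine (sq_le_sq₀ (norm_nonneg _) (norm_nonneg _)).mp ?_
    linarith [sq_nonneg ‖H - W‖]
  have hHW : ‖H - W‖ ≤ ‖H‖ := by
    refine (sq_le_sq₀ (norm_nonneg _) (norm_nonneg _)).mp ?_
    linarith [sq_nonneg ‖W‖]
  obtain ⟨R, hR1, hR2, hR3, hR4⟩ := exists_critical_near hJ hD hXΓ (W := W) hZ
  -- Complementarity ZN = 0 rewrites the size of R through a product of W and H − W, hence to order
  -- ‖H‖².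
  have hV : (1 - X.mat * J.mat) * W.mat * Γ.mat
      = -((1 - X.mat * J.mat) * W.mat * (H - W).mat) := by
    have h1 : (1 - X.mat * J.mat) * ((X + W).mat * (Γ + (H - W)).mat) = 0 := by
      rw [hZN, Matrix.mul_zero]
    rw [← Matrix.mul_assoc, mat_add, Matrix.mul_add, hJ.comp_mul_self, zero_add, mat_add,
      Matrix.mul_add] at h1
    exact eq_neg_of_add_eq_zero_left h1
  have hRn : ‖R‖ ≤ ρ * ‖H‖ ^ 2 := by
    calc ‖R‖ ≤ (2 + ‖Γ‖ * ‖D‖) * ‖(1 - X.mat * J.mat) * W.mat * Γ.mat * D.mat‖ := hR4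
      _ ≤ (2 + g * d) * (‖1 - X.mat * J.mat‖ * ‖H‖ * ‖H‖ * d) := by
        gcongr
        refine (norm_mul_le _ _).trans ?_
        rw [hV, norm_neg, norm_mat]
        gcongr
        refine (norm_mul_le _ _).trans ?_
        rw [norm_mat]
        gcongr
        refine (norm_mul_le _ _).trans ?_
        rw [norm_mat]
        gcongr
      _ = _ := by rw [hρ]; ring
  have hcub : |(Γ.mat * (W.mat * J.mat * W.mat * J.mat * W.mat)).trace| ≤ g * ‖J‖ ^ 2 * ‖H‖ ^ 3 := by
    let B : SymMat n := ofMat (W.mat * J.mat * W.mat * J.mat * W.mat) (by simp [Matrix.mul_assoc])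
    have hB : ‖B‖ ≤ ‖W‖ * ‖J‖ * ‖W‖ * ‖J‖ * ‖W‖ := by
      rw [← norm_mat, ← norm_mat W, ← norm_mat J]
      refine (norm_mul_le _ _).trans ?_
      gcongr
      refine (norm_mul_le _ _).trans ?_
      gcongr
      refine (norm_mul_le _ _).trans ?_
      gcongr
      exact norm_mul_le _ _
    calc _ = |inner ℝ Γ B| := by rw [inner_eq_trace]; rfl
      _ ≤ ‖Γ‖ * ‖B‖ := abs_real_inner_le_norm _ _
      _ ≤ g * (‖H‖ * ‖J‖ * ‖H‖ * ‖J‖ * ‖H‖) := by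
        gcongr
        exact hB.trans (by gcongr)
      _ = _ := by ring
  refine (iInf_le _ (W - R)).trans ?_
  refine (add_le_add_left (secondSubderiv_le hJ hX hXΓ hR1 hR2) _).trans ?_
  rw [← EReal.coe_add, EReal.coe_le_coe_iff, hR3]
  have h1 := hJ.curvature_add_le hΓ hXΓ hZ
  have h2 : ‖W - R - H‖ ^ 2 ≤ ‖H - W‖ ^ 2 + 2 * ρ * ‖H‖ ^ 3 + ρ ^ 2 * ‖H‖ ^ 3 := by
    have e : W - R - H = -((H - W) + R) := by abel
    calc ‖W - R - H‖ ^ 2 ≤ (‖H - W‖ + ‖R‖) ^ 2 := by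
          rw [e, norm_neg]; gcongr; exact norm_add_le _ _
      _ = ‖H - W‖ ^ 2 + 2 * (‖H - W‖ * ‖R‖) + ‖R‖ ^ 2 := by ring
      _ ≤ ‖H - W‖ ^ 2 + 2 * (‖H‖ * (ρ * ‖H‖ ^ 2)) + (ρ * ‖H‖ ^ 2) ^ 2 := by gcongr
      _ = ‖H - W‖ ^ 2 + 2 * ρ * ‖H‖ ^ 3 + ρ ^ 2 * (‖H‖ ^ 3 * ‖H‖) := by ring
      _ ≤ _ := by
        gcongr
        exact mul_le_of_le_one_right (by positivity) hH
  have h3 : ‖Γ + (H - W)‖ ^ 2 = ‖Γ‖ ^ 2 + 2 * (inner ℝ Γ H - inner ℝ Γ W) + ‖H - W‖ ^ 2 := by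
    rw [norm_add_sq_real, inner_sub_right]
  have h4 := neg_abs_le (Γ.mat * (W.mat * J.mat * W.mat * J.mat * W.mat)).trace
  rw [h3]
  norm_num
  linarith

/-- The nonzero eigenvalues of `Γ` are negative eigenvalues of `X + Γ`. -/
theorem exists_eig_add_eq (hΓ : (-Γ.mat).PosSemidef)
    (hXΓ : X.mat * Γ.mat = 0) {i : Fin (Fintype.card (Fin n))} (hi : Γ.eig i ≠ 0) :
    ∃ j, (X + Γ).eig j = Γ.eig i ∧ Γ.eig i < 0 := by
  set e : Fin (Fintype.card (Fin n)) ≃ Fin n := Fintype.equivOfCardEq (Fintype.card_fin _)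
  have hev : Γ.isHermitian.eigenvalues (e i) = Γ.eig i := by
    rw [eigenvalues_eq_eig, Equiv.symm_apply_apply]
  set v : Fin n → ℝ := ⇑(Γ.isHermitian.eigenvectorBasis (e i)) with hv
  have h1 : Γ.mat *ᵥ v = Γ.eig i • v := by
    rw [hv, Γ.isHermitian.mulVec_eigenvectorBasis, hev]
  have hv0 : v ≠ 0 := by
    intro h
    refine Γ.isHermitian.eigenvectorBasis.orthonormal.ne_zero (e i) ?_
    ext k
    exact congrFun h k
  -- An eigenvector of Γ with nonzero eigenvalue lies in the range of Γ, hence in the kernel of X.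
  have h2 : X.mat *ᵥ v = 0 := by
    have : X.mat *ᵥ (Γ.mat *ᵥ v) = 0 := by rw [mulVec_mulVec, hXΓ, zero_mulVec]
    rw [h1, mulVec_smul] at this
    exact (smul_eq_zero.mp this).resolve_left hi
  have h3 : (X + Γ).mat *ᵥ v = Γ.eig i • v := by rw [mat_add, add_mulVec, h1, h2, zero_add]
  have hspec : Γ.eig i ∈ spectrum ℝ (X + Γ).mat := by
    rw [← Matrix.spectrum_toLin']
    refine Module.End.HasEigenvalue.mem_spectrum
      (Module.End.hasEigenvalue_of_hasEigenvector (x := v) ⟨?_, hv0⟩)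
    rw [Module.End.mem_eigenspace_iff, toLin'_apply, h3]
  rw [(X + Γ).isHermitian.spectrum_real_eq_range_eigenvalues] at hspec
  obtain ⟨k, hk⟩ := hspec
  refine ⟨e.symm k, by rw [← hk, eigenvalues_eq_eig], lt_of_le_of_ne ?_ hi⟩
  have h4 := hΓ.dotProduct_mulVec_nonneg v
  rw [star_trivial, neg_mulVec, h1, dotProduct_neg, dotProduct_smul, smul_eq_mul] at h4
  have h5 : 0 < v ⬝ᵥ v := by
    refine lt_of_le_of_ne (Finset.sum_nonneg fun k _ => mul_self_nonneg (v k)) fun h => ?_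
    exact hv0 (dotProduct_self_eq_zero.mp h.symm)
  nlinarith

end SymMat

/-! ### Uniformity over the admissible Γ -/

namespace SymMat

variable {n : ℕ}

/-- Over the matrices `X + Γ` considered, the Moore–Penrose inverse of `Γ` is bounded. -/
theorem exists_bound_isPinv {X Γbar : SymMat n} {r : ℝ}
    (hneg : ∀ i, (X + Γbar).eig i < 0 → r < |(X + Γbar).eig i|) :
    ∃ d : ℝ, ∀ Γ : SymMat n, Γ ∈ normalCone (psdCone n) X → ‖Γ - Γbar‖ ≤ r →
      SamePartition (X + Γ) (X + Γbar) → ∃ D : SymMat n, Γ.IsPinv D ∧ ‖D‖ ≤ d := by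
  -- The margin c is what remains of the negative eigenvalues of X + Γbar after a perturbation of
  -- size r.
  obtain ⟨c, hc, h⟩ : ∃ c > 0, ∀ i, (X + Γbar).eig i < 0 → c ≤ |(X + Γbar).eig i| - r := by
    have := Filter.eventually_all.mpr fun i => show ∀ᶠ c in 𝓝[>] (0 : ℝ),
        (X + Γbar).eig i < 0 → c ≤ |(X + Γbar).eig i| - r by
      by_cases hi : (X + Γbar).eig i < 0
      · filter_upwards [Ioo_mem_nhdsGT (sub_pos.mpr (hneg i hi))] with c hc _ using hc.2.le
      · simp [hi]
    obtain ⟨c, h1, h2⟩ := (this.and self_mem_nhdsWithin).exists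
    exact ⟨c, h2, h1⟩
  refine ⟨√(n * c⁻¹ ^ 2), fun Γ hΓN hr hpart => ?_⟩
  obtain ⟨-, hΓ, hXΓ⟩ := posSemidef_of_mem_normalCone hΓN
  obtain ⟨D, hD, hDn, -⟩ := Γ.exists_isPinv hc fun i hi => by
    obtain ⟨j, hj, hlt⟩ := exists_eig_add_eq hΓ hXΓ hi
    rw [← hj] at hlt ⊢
    have hbar : (X + Γbar).eig j < 0 := by
      have h1 : j ∈ {i | (X + Γ).eig i < 0} := hlt
      rw [hpart.2.2.2] at h1
      exact h1
    have h1 := h j hbar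
    have h2 := eig_le_eig_add_norm_sub (X + Γ) (X + Γbar) j
    rw [add_sub_add_left_eq_sub] at h2
    rw [abs_of_neg hbar] at h1
    rw [abs_of_neg hlt]
    linarith
  exact ⟨D, hD, hDn⟩

end SymMat

/-! ### The uniform expansion -/

open SymMat

theorem mainTheorem4 {𝒳 : Type*} {n : ℕ} (G : 𝒳 → SymMat n) (xbar : 𝒳) (Γbar : SymMat n)
    (hΓbar : Γbar ∈ normalCone (psdCone n) (G xbar))
    (r : ℝ) (hr : 0 < r)
    (hgap : ∀ i j, (G xbar + Γbar).eig j < (G xbar + Γbar).eig i →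
      r < ((G xbar + Γbar).eig i - (G xbar + Γbar).eig j) / 3)
    (hneg : ∀ i, (G xbar + Γbar).eig i < 0 → r < |(G xbar + Γbar).eig i|) :
    ∃ l > (0 : ℝ), ∃ δ > (0 : ℝ), ∀ A Γ : SymMat n,
      A = G xbar + Γ →
      A ∈ Metric.closedBall (G xbar + Γbar) r →
      Γ ∈ normalCone (psdCone n) (G xbar) →
      SamePartition A (G xbar + Γbar) →
      ∀ H : SymMat n, ‖H‖ ≤ δ →
        ∃ a b q : ℝ,
          moreauEnv 1 (convIndicator (psdCone n)) (A + H) = (a : EReal) ∧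
          moreauEnv 1 (convIndicator (psdCone n)) A = (b : EReal) ∧
          moreauEnv (1 / 2) (secondSubderiv (convIndicator (psdCone n)) (G xbar) Γ) H
            = (q : EReal) ∧
          |a - b - (inner ℝ (metricProj (nsdCone n) A) H + 1 / 2 * q)| ≤ l * ‖H‖ ^ 3 := by
  obtain ⟨hX, -, -⟩ := posSemidef_of_mem_normalCone hΓbar
  obtain ⟨J, hJ, hJp⟩ := (G xbar).exists_isPinv_of_posSemidef hX
  obtain ⟨d, hd⟩ := exists_bound_isPinv hneg
  generalize G xbar = X at *
  set k := ‖1 - (1 / 2 : ℝ) • (J.mat * X.mat)‖ * ‖J‖ * ‖1 - (1 / 2 : ℝ) • (X.mat * J.mat)‖ with hk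
  have hk0 : 0 ≤ k := by positivity
  set g := ‖Γbar‖ + r with hg
  have hg0 : 0 ≤ g := by positivity
  set ρ := (2 + g * max d 0) * (‖1 - X.mat * J.mat‖ * max d 0) with hρ
  have hρ0 : 0 ≤ ρ := by positivity
  -- The constants of the two one-sided estimates are added, and the final 1 ensures l > 0. The
  -- radius 1 lets ‖H‖⁴ be absorbed into ‖H‖³.
  refine ⟨(8 * k + 16 * k ^ 2) + (2 * ρ + ρ ^ 2 + 2 * (g * ‖J‖ ^ 2)) + 1, by positivity, 1, one_pos,
    ?_⟩
  rintro A Γ rfl hball hΓN hpart H hH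
  rw [Metric.mem_closedBall, dist_eq_norm, add_sub_add_left_eq_sub] at hball
  obtain ⟨-, hΓ, hXΓ⟩ := posSemidef_of_mem_normalCone hΓN
  obtain ⟨D, hD, hDn⟩ := hd Γ hΓN hball hpart
  obtain ⟨Z, N, hsum, hZ, hN, hZN⟩ := (X + Γ + H).exists_posSemidef_add
  have hΓg : ‖Γ‖ ≤ g := by
    have := norm_add_le Γbar (Γ - Γbar)
    rw [add_sub_cancel] at this
    linarith
  have hlow := le_moreauEnv_secondSubderiv hJ hX hΓ hXΓ hJp hN hZN hsum hk0
    (fun W => norm_correction_le W) hH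
  have hupp := moreauEnv_secondSubderiv_le hJ hX hΓ hXΓ hD hZ hN hZN hsum hΓg
    (hDn.trans (le_max_left d 0)) hρ hH
  set E := moreauEnv (1 / 2) (secondSubderiv (convIndicator (psdCone n)) X Γ) H
  -- The two real bounds make the envelope finite.
  have hE : E = ((E.toReal : ℝ) : EReal) := (EReal.coe_toReal
    (ne_top_of_le_ne_top (EReal.coe_ne_top _) hupp)
    (ne_bot_of_le_ne_bot (EReal.coe_ne_bot _) hlow)).symm
  refine ⟨1 / 2 * ‖N‖ ^ 2, 1 / 2 * ‖Γ‖ ^ 2, E.toReal, ?_, moreauEnv_one_indicator hX hΓ hXΓ, hE, ?_⟩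
  · rw [hsum]
    exact moreauEnv_one_indicator hZ hN hZN
  rw [hE, EReal.coe_le_coe_iff] at hlow hupp
  rw [metricProj_nsdCone hX hΓ hXΓ, abs_le]
  have h1 : 0 ≤ (8 * k + 16 * k ^ 2) * ‖H‖ ^ 3 := by positivity
  have h2 : 0 ≤ (2 * ρ + ρ ^ 2 + 2 * (g * ‖J‖ ^ 2)) * ‖H‖ ^ 3 := by positivity
  have h3 : 0 ≤ ‖H‖ ^ 3 := by positivity
  constructor <;> linarith
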